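/- For Heyting algebras $A$ and $B$ let $A+B$ denote their concatenation, obtained by putting $B$ on top of $A$ and identifying the top element of $A$ with the bottom element of $B$ (in expressions, $\times$ binds more strongly than $+$). Let $Z$ be the Rieger–Nishimura ladder, i.e. the free Heyting algebra on one generator, let $Z_2$ be the two-element Boolean algebra, and put $Z' = Z\times Z_2+Z_2$. For a Heyting algebra $H$ let $s(H)$ be its modal span: the interior algebra whose underlying Boolean algebra is the free Boolean extension of the bounded lattice $H$, with $\Box x=\bigwedge_{i=1}^n(a_i\to b_i)$ (implication of $H$) whenever $x=\bigwedge_{i=1}^n(\neg a_i\vee b_i)$ with $a_i,b_i\in H$. For an interior algebra $K$ let $\mathcal V(K)$ be the variety of interior algebras generated by $K$. An interior algebra $S$ is finitely presentable over a variety $\mathcal M$ of interior algebras if $S\in\mathcal M$ and there are a modal formula $\varphi(p_1,\dots,p_n)$ and elements $a_1,\dots,a_n$ generating $S$ such that $\varphi(a_1,\dots,a_n)=1$ and, for every modal formula $\psi(p_1,\dots,p_n)$ with $\psi(a_1,\dots,a_n)=1$, the formula $\Box\varphi\to\psi$ is valid in every algebra of $\mathcal M$. Theorem. For every non-degenerate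 Heyting algebra $A$, the interior algebra $s(Z')$ is finitely presentable over the variety $\mathcal V\bigl(s(Z\times Z_2+A)\bigr)$. In particular, there are infinite subdirectly irreducible interior algebras $S$ that are finitely presentable over $\mathcal V(S)$: the algebra $S=s(Z')$ is infinite, subdirectly irreducible, and finitely presentable over $\mathcal V(s(Z'))$. -/

import Mathlib

universe u v w

/-! ### Heyting algebras: free algebras, the Rieger–Nishimura ladder, concatenation -/

/-- Terms in the language of Heyting algebras over a set `X` of generators. -/
inductive HeytTerm (X : Type u) : Type u
  | var : X → HeytTerm X
  | bot : HeytTerm X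
  | top : HeytTerm X
  | inf : HeytTerm X → HeytTerm X → HeytTerm X
  | sup : HeytTerm X → HeytTerm X → HeytTerm X
  | imp : HeytTerm X → HeytTerm X → HeytTerm X

/-- The least preorder on terms that satisfies the laws of Heyting algebras, that is,
derivability `s ⊢ t` in intuitionistic propositional logic. -/
inductive HeytTerm.Le {X : Type u} : HeytTerm X → HeytTerm X → Prop
  | refl (a : HeytTerm X) : Le a a
  | trans {a b c : HeytTerm X} : Le a b → Le b c → Le a c
  | bot_le (a : HeytTerm X) : Le bot a
  | le_top (a : HeytTerm X) : Le a top
  | inf_left (a b : HeytTerm X) : Le (inf a b) a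
  | inf_right (a b : HeytTerm X) : Le (inf a b) b
  | le_inf {a b c : HeytTerm X} : Le a b → Le a c → Le a (inf b c)
  | sup_left (a b : HeytTerm X) : Le a (sup a b)
  | sup_right (a b : HeytTerm X) : Le b (sup a b)
  | sup_le {a b c : HeytTerm X} : Le a c → Le b c → Le (sup a b) c
  | imp_intro {a b c : HeytTerm X} : Le (inf a b) c → Le a (imp b c)
  | imp_elim {a b c : HeytTerm X} : Le a (imp b c) → Le (inf a b) c

instance HeytTerm.setoid (X : Type u) : Setoid (HeytTerm X) where
  r s t := HeytTerm.Le s t ∧ HeytTerm.Le t s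
  iseqv := ⟨fun a => ⟨.refl a, .refl a⟩, fun h => ⟨h.2, h.1⟩,
    fun h k => ⟨h.1.trans k.1, k.2.trans h.2⟩⟩

/-- The free Heyting algebra over `X`: terms modulo the laws of Heyting algebras. -/
def FreeHeyting (X : Type u) : Type u := Quotient (HeytTerm.setoid X)

namespace FreeHeyting

variable {X : Type u}

/-- The class of a term. -/
def mk (t : HeytTerm X) : FreeHeyting X := Quotient.mk _ t

/-- The free generators. -/
def of (x : X) : FreeHeyting X := mk (.var x)

instance : LE (FreeHeyting X) where
  le := Quotient.lift₂ HeytTerm.Le fun _ _ _ _ h k =>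
    propext ⟨fun l => h.2.trans (l.trans k.1), fun l => h.1.trans (l.trans k.2)⟩

/-- Implication on classes of terms. -/
def imp : FreeHeyting X → FreeHeyting X → FreeHeyting X :=
  Quotient.map₂ HeytTerm.imp fun _ _ h _ _ k =>
    ⟨.imp_intro (.trans (.le_inf (.inf_left _ _) (.trans (.inf_right _ _) h.2))
        (.trans (.imp_elim (.refl _)) k.1)),
      .imp_intro (.trans (.le_inf (.inf_left _ _) (.trans (.inf_right _ _) h.1))
        (.trans (.imp_elim (.refl _)) k.2))⟩

instance : HeytingAlgebra (FreeHeyting X) where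
  le_refl := by rintro ⟨a⟩; exact .refl a
  le_trans := by rintro ⟨a⟩ ⟨b⟩ ⟨c⟩ h k; exact HeytTerm.Le.trans h k
  le_antisymm := by rintro ⟨a⟩ ⟨b⟩ h k; exact Quotient.sound ⟨h, k⟩
  inf := Quotient.map₂ HeytTerm.inf fun _ _ h _ _ k =>
    ⟨.le_inf (.trans (.inf_left _ _) h.1) (.trans (.inf_right _ _) k.1),
      .le_inf (.trans (.inf_left _ _) h.2) (.trans (.inf_right _ _) k.2)⟩
  sup := Quotient.map₂ HeytTerm.sup fun _ _ h _ _ k =>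
    ⟨.sup_le (.trans h.1 (.sup_left _ _)) (.trans k.1 (.sup_right _ _)),
      .sup_le (.trans h.2 (.sup_left _ _)) (.trans k.2 (.sup_right _ _))⟩
  himp := imp
  compl a := imp a (mk .bot)
  top := mk .top
  bot := mk .bot
  inf_le_left := by rintro ⟨a⟩ ⟨b⟩; exact .inf_left a b
  inf_le_right := by rintro ⟨a⟩ ⟨b⟩; exact .inf_right a b
  le_inf := by rintro ⟨a⟩ ⟨b⟩ ⟨c⟩ h k; exact HeytTerm.Le.le_inf h k
  le_sup_left := by rintro ⟨a⟩ ⟨b⟩; exact .sup_left a b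
  le_sup_right := by rintro ⟨a⟩ ⟨b⟩; exact .sup_right a b
  sup_le := by rintro ⟨a⟩ ⟨b⟩ ⟨c⟩ h k; exact HeytTerm.Le.sup_le h k
  le_top := by rintro ⟨a⟩; exact .le_top a
  bot_le := by rintro ⟨a⟩; exact .bot_le a
  le_himp_iff := by
    rintro ⟨a⟩ ⟨b⟩ ⟨c⟩
    exact ⟨fun h => HeytTerm.Le.imp_elim h, fun h => HeytTerm.Le.imp_intro h⟩
  himp_bot := by rintro ⟨a⟩; rfl

end FreeHeyting

/-- The Rieger–Nishimura ladder `Z`: the free Heyting algebra on one generator. -/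
abbrev RiegerNishimura : Type := FreeHeyting Unit

/-- The concatenation `A + B`: the algebra `B` is put on top of `A`, and the top of `A` is
identified with the bottom of `B`. An element `a` of `A` is represented by `(a, ⊥)` and an
element `b` of `B` by `(⊤, b)`; the order is componentwise, so that every element of `A` lies
below every element of `B`. -/
def Concat (A : Type u) (B : Type v) [HeytingAlgebra A] [HeytingAlgebra B] : Type (max u v) :=
  {x : A × B // x.1 = ⊤ ∨ x.2 = ⊥}

namespace Concat

variable {A : Type u} {B : Type v} [HeytingAlgebra A] [HeytingAlgebra B]

/-- The copy of `A` in `A + B`. -/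
def inl (a : A) : Concat A B := ⟨(a, ⊥), Or.inr rfl⟩

/-- The copy of `B` in `A + B`. -/
def inr (b : B) : Concat A B := ⟨(⊤, b), Or.inl rfl⟩

instance : PartialOrder (Concat A B) := inferInstanceAs (PartialOrder {x : A × B // x.1 = ⊤ ∨ x.2 = ⊥})

instance : Lattice (Concat A B) where
  inf x y := ⟨x.1 ⊓ y.1, by
    rw [Prod.fst_inf, Prod.snd_inf]
    rcases x.2 with h | h <;> rcases y.2 with k | k <;> rw [h, k] <;> simp⟩
  sup x y := ⟨x.1 ⊔ y.1, by
    rw [Prod.fst_sup, Prod.snd_sup]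
    rcases x.2 with h | h <;> rcases y.2 with k | k <;> rw [h, k] <;> simp⟩
  inf_le_left x y := (inf_le_left : x.1 ⊓ y.1 ≤ x.1)
  inf_le_right x y := (inf_le_right : x.1 ⊓ y.1 ≤ y.1)
  le_inf x y z h k := (_root_.le_inf h k : x.1 ≤ y.1 ⊓ z.1)
  le_sup_left x y := (le_sup_left : x.1 ≤ x.1 ⊔ y.1)
  le_sup_right x y := (le_sup_right : y.1 ≤ x.1 ⊔ y.1)
  sup_le x y z h k := (_root_.sup_le h k : x.1 ⊔ y.1 ≤ z.1)

instance : BoundedOrder (Concat A B) where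
  top := ⟨(⊤, ⊤), Or.inl rfl⟩
  bot := ⟨(⊥, ⊥), Or.inr rfl⟩
  le_top x := (le_top : x.1 ≤ ⊤)
  bot_le x := (bot_le : ⊥ ≤ x.1)

open scoped Classical in
/-- Relative pseudo-complement in `A + B`. -/
noncomputable def himp (x y : Concat A B) : Concat A B :=
  if x.1.1 ≤ y.1.1 then inr (x.1.2 ⇨ y.1.2) else inl (x.1.1 ⇨ y.1.1)

theorem le_himp (x y z : Concat A B) : x ≤ himp y z ↔ x ⊓ y ≤ z := by
  have key : x ⊓ y ≤ z ↔ (x.1.1 ⊓ y.1.1 ≤ z.1.1 ∧ x.1.2 ⊓ y.1.2 ≤ z.1.2) := Iff.rfl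
  rw [key]
  unfold himp
  split_ifs with h
  · change (x.1.1 ≤ ⊤ ∧ x.1.2 ≤ y.1.2 ⇨ z.1.2) ↔ _
    simp [le_himp_iff, inf_le_of_right_le h]
  · change (x.1.1 ≤ y.1.1 ⇨ z.1.1 ∧ x.1.2 ≤ ⊥) ↔ _
    rw [le_himp_iff]
    refine and_congr_right fun hac => ?_
    have hb : x.1.2 = ⊥ := by
      rcases x.2 with hx | hx
      · rw [hx, top_inf_eq] at hac
        exact absurd hac h
      · exact hx
    simp [hb]

noncomputable instance : HeytingAlgebra (Concat A B) where
  himp := himp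
  compl x := himp x ⊥
  le_top := fun _ => le_top
  bot_le := fun _ => bot_le
  le_himp_iff := le_himp
  himp_bot _ := rfl

end Concat

/-- The algebra `Z × Z₂ + A`, where `Z₂` is the two-element Boolean algebra. -/
abbrev ZStar (A : Type u) [HeytingAlgebra A] : Type u := Concat (RiegerNishimura × Bool) A

/-- The algebra `Z' = Z × Z₂ + Z₂`. -/
abbrev ZPrime : Type := ZStar Bool

/-! ### Interior algebras, modal formulas, varieties, finite presentability -/

/-- Interior algebras (topological Boolean algebras, `S4`-algebras). -/
class InteriorAlgebra (S : Type u) extends BooleanAlgebra S where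
  box : S → S
  box_top : box ⊤ = ⊤
  box_inf : ∀ a b : S, box (a ⊓ b) = box a ⊓ box b
  box_le : ∀ a : S, box a ≤ a
  box_box : ∀ a : S, box (box a) = box a

/-- Modal formulas (terms in the signature of interior algebras) with variables in `X`. -/
inductive ModalFormula (X : Type u) : Type u
  | var : X → ModalFormula X
  | and : ModalFormula X → ModalFormula X → ModalFormula X
  | or : ModalFormula X → ModalFormula X → ModalFormula X
  | imp : ModalFormula X → ModalFormula X → ModalFormula X
  | neg : ModalFormula X → ModalFormula X
  | box : ModalFormula X → ModalFormula X

/-- The value of a formula in an interior algebra under a valuation. -/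
def ModalFormula.eval {X : Type u} {S : Type v} [InteriorAlgebra S] (a : X → S) :
    ModalFormula X → S
  | var x => a x
  | and φ ψ => eval a φ ⊓ eval a ψ
  | or φ ψ => eval a φ ⊔ eval a ψ
  | imp φ ψ => eval a φ ⇨ eval a ψ
  | neg φ => (eval a φ)ᶜ
  | box φ => InteriorAlgebra.box (eval a φ)

/-- A variety of interior algebras, given by a set of identities `s ≈ t`. -/
structure InteriorVariety where
  identities : Set (ModalFormula ℕ × ModalFormula ℕ)

namespace InteriorVariety

/-- `S` belongs to the variety. -/
def Mem (V : InteriorVariety) (S : Type u) [InteriorAlgebra S] : Prop :=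
  ∀ e ∈ V.identities, ∀ a : ℕ → S, e.1.eval a = e.2.eval a

/-- The variety generated by `K`: the smallest variety that contains `K`, namely the class of
all interior algebras that satisfy every identity of `K`. -/
def generatedBy (K : Type u) [InteriorAlgebra K] : InteriorVariety where
  identities := {e | ∀ a : ℕ → K, e.1.eval a = e.2.eval a}

theorem mem_generatedBy (K : Type u) [InteriorAlgebra K] : (generatedBy K).Mem K :=
  fun _ he => he

theorem generatedBy_least (K : Type u) [InteriorAlgebra K] (V : InteriorVariety) (hK : V.Mem K)
    (S : Type v) [InteriorAlgebra S] (hS : (generatedBy K).Mem S) : V.Mem S :=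
  fun e he => hS e (hK e he)

/-- `⊢_V φ`: the formula `φ` is valid in every algebra of the variety. -/
def Valid (V : InteriorVariety) {X : Type u} (φ : ModalFormula X) : Prop :=
  ∀ (S : Type w) [InteriorAlgebra S], V.Mem S → ∀ a : X → S, φ.eval a = ⊤

end InteriorVariety

/-- The family `a` generates the interior algebra `S`: the only subalgebra that contains all
`a i` is `S`. -/
def GeneratesInterior {S : Type u} [InteriorAlgebra S] {X : Type v} (a : X → S) : Prop :=
  ∀ T : Set S, (∀ i, a i ∈ T) →
    (∀ x ∈ T, ∀ y ∈ T, x ⊓ y ∈ T) → (∀ x ∈ T, ∀ y ∈ T, x ⊔ y ∈ T) →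
    (∀ x ∈ T, ∀ y ∈ T, x ⇨ y ∈ T) → (∀ x ∈ T, xᶜ ∈ T) →
    (∀ x ∈ T, InteriorAlgebra.box x ∈ T) → T = Set.univ

/-- The formula `φ(p₁, …, pₙ)` together with the valuation `pᵢ ↦ aᵢ` defines the algebra `S`
over the variety `V`. -/
def DefinesInterior (V : InteriorVariety) {S : Type u} [InteriorAlgebra S] {n : ℕ}
    (φ : ModalFormula (Fin n)) (a : Fin n → S) : Prop :=
  GeneratesInterior a ∧ φ.eval a = ⊤ ∧
    ∀ ψ : ModalFormula (Fin n), ψ.eval a = ⊤ →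
      InteriorVariety.Valid.{0, w} V (ModalFormula.imp (ModalFormula.box φ) ψ)

/-- `S` is finitely presentable over the variety `V`: it belongs to `V` and is defined over `V`
by some formula and valuation. -/
def FinitelyPresentableOver (V : InteriorVariety) (S : Type u) [InteriorAlgebra S] : Prop :=
  V.Mem S ∧ ∃ (n : ℕ) (φ : ModalFormula (Fin n)) (a : Fin n → S), DefinesInterior.{u, w} V φ a

/-- Congruences of an interior algebra. -/
structure IsInteriorCongruence {S : Type u} [InteriorAlgebra S] (r : S → S → Prop) : Prop where
  equivalence : Equivalence r
  inf : ∀ {a b c d : S}, r a b → r c d → r (a ⊓ c) (b ⊓ d)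
  sup : ∀ {a b c d : S}, r a b → r c d → r (a ⊔ c) (b ⊔ d)
  himp : ∀ {a b c d : S}, r a b → r c d → r (a ⇨ c) (b ⇨ d)
  compl : ∀ {a b : S}, r a b → r aᶜ bᶜ
  box : ∀ {a b : S}, r a b → r (InteriorAlgebra.box a) (InteriorAlgebra.box b)

/-- `S` is subdirectly irreducible: it has a least congruence among those different from
equality, that is, there are two distinct elements that are identified by every congruence
different from equality. -/
def IsSubdirectlyIrreducible (S : Type u) [InteriorAlgebra S] : Prop :=
  ∃ a b : S, a ≠ b ∧
    ∀ r : S → S → Prop, IsInteriorCongruence r → (∃ x y, x ≠ y ∧ r x y) → r a b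

/-! ### The modal span of a Heyting algebra -/

/-- Boolean terms over the elements of `H`. -/
inductive BoolTerm (H : Type u) : Type u
  | of : H → BoolTerm H
  | bot : BoolTerm H
  | top : BoolTerm H
  | inf : BoolTerm H → BoolTerm H → BoolTerm H
  | sup : BoolTerm H → BoolTerm H → BoolTerm H
  | compl : BoolTerm H → BoolTerm H

/-- The least preorder on Boolean terms over `H` that satisfies the laws of Boolean algebras and
makes the inclusion of `H` a homomorphism of bounded lattices. -/
inductive BoolTerm.Le {H : Type u} [HeytingAlgebra H] : BoolTerm H → BoolTerm H → Prop
  | refl (a : BoolTerm H) : Le a a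
  | trans {a b c : BoolTerm H} : Le a b → Le b c → Le a c
  | bot_le (a : BoolTerm H) : Le bot a
  | le_top (a : BoolTerm H) : Le a top
  | inf_left (a b : BoolTerm H) : Le (inf a b) a
  | inf_right (a b : BoolTerm H) : Le (inf a b) b
  | le_inf {a b c : BoolTerm H} : Le a b → Le a c → Le a (inf b c)
  | sup_left (a b : BoolTerm H) : Le a (sup a b)
  | sup_right (a b : BoolTerm H) : Le b (sup a b)
  | sup_le {a b c : BoolTerm H} : Le a c → Le b c → Le (sup a b) c
  | distrib (a b c : BoolTerm H) : Le (inf (sup a b) (sup a c)) (sup a (inf b c))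
  | inf_compl (a : BoolTerm H) : Le (inf a (compl a)) bot
  | sup_compl (a : BoolTerm H) : Le top (sup a (compl a))
  | compl_anti {a b : BoolTerm H} : Le a b → Le (compl b) (compl a)
  | of_bot : Le (of ⊥) bot
  | of_top : Le top (of ⊤)
  | of_mono {a b : H} : a ≤ b → Le (of a) (of b)
  | of_inf (a b : H) : Le (inf (of a) (of b)) (of (a ⊓ b))
  | of_sup (a b : H) : Le (of (a ⊔ b)) (sup (of a) (of b))

instance BoolTerm.setoid (H : Type u) [HeytingAlgebra H] : Setoid (BoolTerm H) where
  r s t := BoolTerm.Le s t ∧ BoolTerm.Le t s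
  iseqv := ⟨fun a => ⟨.refl a, .refl a⟩, fun h => ⟨h.2, h.1⟩,
    fun h k => ⟨h.1.trans k.1, k.2.trans h.2⟩⟩

/-- The modal span `s(H)`. Its carrier is the free Boolean extension of the bounded lattice `H`:
Boolean terms over `H` modulo the laws of Boolean algebras and the lattice relations of `H`. -/
def ModalSpan (H : Type u) [HeytingAlgebra H] : Type u := Quotient (BoolTerm.setoid H)

namespace ModalSpan

variable {H : Type u} [HeytingAlgebra H]

/-- The class of a term. -/
def mk (t : BoolTerm H) : ModalSpan H := Quotient.mk _ t

/-- The inclusion of `H` into its free Boolean extension. -/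
def of (a : H) : ModalSpan H := mk (.of a)

instance : LE (ModalSpan H) where
  le := Quotient.lift₂ BoolTerm.Le fun _ _ _ _ h k =>
    propext ⟨fun l => h.2.trans (l.trans k.1), fun l => h.1.trans (l.trans k.2)⟩

instance : BooleanAlgebra (ModalSpan H) where
  le_refl := by rintro ⟨a⟩; exact .refl a
  le_trans := by rintro ⟨a⟩ ⟨b⟩ ⟨c⟩ h k; exact BoolTerm.Le.trans h k
  le_antisymm := by rintro ⟨a⟩ ⟨b⟩ h k; exact Quotient.sound ⟨h, k⟩
  inf := Quotient.map₂ BoolTerm.inf fun _ _ h _ _ k =>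
    ⟨.le_inf (.trans (.inf_left _ _) h.1) (.trans (.inf_right _ _) k.1),
      .le_inf (.trans (.inf_left _ _) h.2) (.trans (.inf_right _ _) k.2)⟩
  sup := Quotient.map₂ BoolTerm.sup fun _ _ h _ _ k =>
    ⟨.sup_le (.trans h.1 (.sup_left _ _)) (.trans k.1 (.sup_right _ _)),
      .sup_le (.trans h.2 (.sup_left _ _)) (.trans k.2 (.sup_right _ _))⟩
  compl := Quotient.map BoolTerm.compl fun _ _ h => ⟨.compl_anti h.2, .compl_anti h.1⟩
  top := mk .top
  bot := mk .bot
  inf_le_left := by rintro ⟨a⟩ ⟨b⟩; exact .inf_left a b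
  inf_le_right := by rintro ⟨a⟩ ⟨b⟩; exact .inf_right a b
  le_inf := by rintro ⟨a⟩ ⟨b⟩ ⟨c⟩ h k; exact BoolTerm.Le.le_inf h k
  le_sup_left := by rintro ⟨a⟩ ⟨b⟩; exact .sup_left a b
  le_sup_right := by rintro ⟨a⟩ ⟨b⟩; exact .sup_right a b
  sup_le := by rintro ⟨a⟩ ⟨b⟩ ⟨c⟩ h k; exact BoolTerm.Le.sup_le h k
  le_top := by rintro ⟨a⟩; exact .le_top a
  bot_le := by rintro ⟨a⟩; exact .bot_le a
  le_sup_inf := by rintro ⟨a⟩ ⟨b⟩ ⟨c⟩; exact .distrib a b c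
  inf_compl_le_bot := by rintro ⟨a⟩; exact .inf_compl a
  top_le_sup_compl := by rintro ⟨a⟩; exact .sup_compl a
  sdiff_eq := fun _ _ => rfl
  himp_eq := fun _ _ => rfl

theorem of_mono {a b : H} (h : a ≤ b) : of a ≤ of b := BoolTerm.Le.of_mono h

theorem of_bot : of (⊥ : H) = ⊥ := le_bot_iff.1 BoolTerm.Le.of_bot

theorem of_top : of (⊤ : H) = ⊤ := top_le_iff.1 BoolTerm.Le.of_top

theorem of_inf (a b : H) : of (a ⊓ b) = of a ⊓ of b :=
  le_antisymm (le_inf (of_mono inf_le_left) (of_mono inf_le_right)) (BoolTerm.Le.of_inf a b)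

theorem of_sup (a b : H) : of (a ⊔ b) = of a ⊔ of b :=
  le_antisymm (BoolTerm.Le.of_sup a b) (sup_le (of_mono le_sup_left) (of_mono le_sup_right))

theorem induction {P : ModalSpan H → Prop} (h_of : ∀ a, P (of a))
    (h_inf : ∀ x y, P x → P y → P (x ⊓ y)) (h_compl : ∀ x, P x → P xᶜ) (x : ModalSpan H) :
    P x := by
  obtain ⟨t⟩ := x
  change P (mk t)
  induction t with
  | of a => exact h_of a
  | bot => exact (of_bot (H := H) ▸ h_of ⊥ : P ⊥)
  | top => exact (of_top (H := H) ▸ h_of ⊤ : P ⊤)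
  | inf a b ha hb => exact h_inf _ _ ha hb
  | sup a b ha hb =>
    have := h_compl _ (h_inf _ _ (h_compl _ ha) (h_compl _ hb))
    rw [compl_inf, compl_compl, compl_compl] at this
    exact this
  | compl a ha => exact h_compl _ ha

/-- The element `⋀ᵢ (¬ aᵢ ∨ bᵢ)` of the free Boolean extension. -/
def cnf (l : List (H × H)) : ModalSpan H :=
  (l.map fun p => (of p.1)ᶜ ⊔ of p.2).foldr (· ⊓ ·) ⊤

/-- The element `⋀ᵢ (aᵢ → bᵢ)` of `H`. -/
def impInf (l : List (H × H)) : H :=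
  (l.map fun p => p.1 ⇨ p.2).foldr (· ⊓ ·) ⊤

theorem cnf_append (l m : List (H × H)) : cnf (l ++ m) = cnf l ⊓ cnf m := by
  induction l with
  | nil => simp [cnf]
  | cons p l ih =>
    have h : cnf (p :: (l ++ m)) = ((of p.1)ᶜ ⊔ of p.2) ⊓ cnf (l ++ m) := rfl
    have h' : cnf (p :: l) = ((of p.1)ᶜ ⊔ of p.2) ⊓ cnf l := rfl
    rw [List.cons_append, h, h', ih, inf_assoc]

theorem exists_cnf_sup_one (p : H × H) (m : List (H × H)) :
    ∃ k, cnf k = ((of p.1)ᶜ ⊔ of p.2) ⊔ cnf m := by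
  induction m with
  | nil => exact ⟨[], by simp [cnf]⟩
  | cons q m ih =>
    obtain ⟨k, hk⟩ := ih
    refine ⟨(p.1 ⊓ q.1, p.2 ⊔ q.2) :: k, ?_⟩
    have h : cnf (q :: m) = ((of q.1)ᶜ ⊔ of q.2) ⊓ cnf m := rfl
    have h' : cnf ((p.1 ⊓ q.1, p.2 ⊔ q.2) :: k) =
      ((of (p.1 ⊓ q.1))ᶜ ⊔ of (p.2 ⊔ q.2)) ⊓ cnf k := rfl
    rw [h, h', hk, of_inf, of_sup, compl_inf, sup_inf_left, sup_sup_sup_comm]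

theorem exists_cnf_sup (l m : List (H × H)) : ∃ k, cnf k = cnf l ⊔ cnf m := by
  induction l with
  | nil => exact ⟨[], by simp [cnf]⟩
  | cons p l ih =>
    obtain ⟨k, hk⟩ := ih
    obtain ⟨k', hk'⟩ := exists_cnf_sup_one p m
    refine ⟨k' ++ k, ?_⟩
    have h : cnf (p :: l) = ((of p.1)ᶜ ⊔ of p.2) ⊓ cnf l := rfl
    rw [cnf_append, hk, hk', h, sup_inf_right]

theorem exists_cnf_compl (l : List (H × H)) : ∃ k, cnf k = (cnf l)ᶜ := by
  induction l with
  | nil => exact ⟨[(⊤, ⊥)], by simp [cnf, of_top, of_bot]⟩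
  | cons p l ih =>
    obtain ⟨k, hk⟩ := ih
    obtain ⟨k', hk'⟩ := exists_cnf_sup [(⊤, p.1), (p.2, ⊥)] k
    refine ⟨k', ?_⟩
    have h : cnf (p :: l) = ((of p.1)ᶜ ⊔ of p.2) ⊓ cnf l := rfl
    rw [hk', hk, h, compl_inf, compl_sup, compl_compl]
    simp [cnf, of_top, of_bot]

/-- Every element of the free Boolean extension has the form `⋀ᵢ (¬ aᵢ ∨ bᵢ)`. -/
theorem exists_cnf (x : ModalSpan H) : ∃ l, cnf l = x := by
  refine induction (P := fun x => ∃ l, cnf l = x) (fun a => ⟨[(⊤, a)], by simp [cnf, of_top]⟩) ?_ ?_ x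
  · rintro _ _ ⟨l, rfl⟩ ⟨m, rfl⟩
    exact ⟨l ++ m, cnf_append l m⟩
  · rintro _ ⟨l, rfl⟩
    exact exists_cnf_compl l

/-- A prime ideal of `H` yields a two-valued interpretation of Boolean terms. -/
def holds (J : Set H) : BoolTerm H → Prop
  | .of a => a ∉ J
  | .bot => False
  | .top => True
  | .inf s t => holds J s ∧ holds J t
  | .sup s t => holds J s ∨ holds J t
  | .compl s => ¬ holds J s

theorem holds_mono (J : Order.Ideal H) (hJ : J.IsPrime) {s t : BoolTerm H}
    (h : BoolTerm.Le s t) : holds (J : Set H) s → holds (J : Set H) t := by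
  induction h with
  | of_bot => exact fun h => h J.bot_mem
  | of_top => exact fun _ => hJ.toIsProper.top_notMem
  | of_mono h => exact fun h' k => h' (J.lower h k)
  | of_inf a b => exact fun h k => (hJ.mem_or_mem k).elim h.1 h.2
  | of_sup a b =>
    intro h
    by_contra k
    simp only [holds, not_or, not_not] at k
    exact h (J.sup_mem k.1 k.2)
  | trans _ _ h k => exact fun l => k (h l)
  | refl => exact id
  | compl_anti _ h => exact fun k l => k (h l)
  | _ => simp only [holds] at *; tauto

/-- The inclusion of `H` into its free Boolean extension is an order embedding. -/
theorem of_le_of {a b : H} : of a ≤ of b ↔ a ≤ b := by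
  refine ⟨fun h => ?_, of_mono⟩
  by_contra hab
  have hd : Disjoint ((Order.PFilter.principal a : Order.PFilter H) : Set H)
      ((Order.Ideal.principal b : Order.Ideal H) : Set H) := by
    rw [Set.disjoint_left]
    intro x hx hx'
    exact hab (le_trans hx hx')
  obtain ⟨J, hJ, hbJ, haJ⟩ := DistribLattice.prime_ideal_of_disjoint_filter_ideal hd
  have ha : a ∉ J := fun k => Set.disjoint_left.1 haJ (show a ≤ a from le_rfl) k
  exact holds_mono J hJ h ha (hbJ (show b ≤ b from le_rfl))

theorem of_le_cnf (h : H) (l : List (H × H)) : of h ≤ cnf l ↔ h ≤ impInf l := by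
  induction l with
  | nil => simp [cnf, impInf]
  | cons p l ih =>
    have h₁ : cnf (p :: l) = ((of p.1)ᶜ ⊔ of p.2) ⊓ cnf l := rfl
    have h₂ : impInf (p :: l) = (p.1 ⇨ p.2) ⊓ impInf l := rfl
    rw [h₁, h₂, le_inf_iff, le_inf_iff, ih, le_himp_iff, ← of_le_of (a := h ⊓ p.1), of_inf, sup_comm, ← himp_eq,
      le_himp_iff]

/-- The interior operation: if `x = ⋀ᵢ (¬ aᵢ ∨ bᵢ)` then `□ x = ⋀ᵢ (aᵢ → bᵢ)`. -/
noncomputable def box (x : ModalSpan H) : ModalSpan H := of (impInf (exists_cnf x).choose)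

theorem of_le_box (h : H) (x : ModalSpan H) : of h ≤ box x ↔ of h ≤ x := by
  conv_rhs => rw [← (exists_cnf x).choose_spec]
  rw [box, of_le_of, of_le_cnf]

/-- The interior operation does not depend on the chosen representation. -/
theorem box_cnf (l : List (H × H)) : box (cnf l) = of (impInf l) := by
  refine le_antisymm ?_ ?_
  · have h := (of_le_box (impInf (exists_cnf (cnf l)).choose) (cnf l)).1 le_rfl
    exact of_mono ((of_le_cnf _ _).1 h)
  · exact (of_le_box _ _).2 ((of_le_cnf _ _).2 le_rfl)

theorem box_le_self (x : ModalSpan H) : box x ≤ x :=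
  (of_le_box (impInf (exists_cnf x).choose) x).1 le_rfl

theorem box_mono {x y : ModalSpan H} (h : x ≤ y) : box x ≤ box y :=
  (of_le_box (impInf (exists_cnf x).choose) y).2 ((box_le_self x).trans h)

theorem box_of (a : H) : box (of a) = of a :=
  le_antisymm (box_le_self _) ((of_le_box a _).2 le_rfl)

noncomputable instance : InteriorAlgebra (ModalSpan H) where
  box := box
  box_top := by rw [← of_top, box_of]
  box_inf x y := by
    refine le_antisymm (le_inf (box_mono inf_le_left) (box_mono inf_le_right)) ?_
    have h : box x ⊓ box y =
        of (impInf (exists_cnf x).choose ⊓ impInf (exists_cnf y).choose) := by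
      rw [of_inf]; rfl
    rw [h, of_le_box, ← h]
    exact inf_le_inf (box_le_self x) (box_le_self y)
  box_le := box_le_self
  box_box x := box_of _

end ModalSpan

/-! Let `g` generate `Z`. Three open elements present `s(Z')`: `x₀ = (g, 0)`, `x₁ = (⊤, 0)` and `x₂
= (⊥, 1)`. The relations say that `x₀ ≤ x₁`, that `x₁` and `x₂` are each other's pseudo-complements,
and that `x₁ → t(x₀) ≤ x₁ ∨ x₂`, where `t(x) = (¬¬x → x) ∨ ¬x ∨ ¬¬x`. The term `t` singles out `g`:
it is `⊤` at every other element of `Z`, but not at `g` (`ladderTerm_eq_top`,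
`ladderTerm_gen_ne_top`).

A formula valid in a generating algebra is valid in its variety, so consequences of the presentation
need checking only in `s(Z × Z₂ + A)`. For a valuation there, the box of the presentation is an open
element `c`, and passing to the quotient by the filter of `c` turns the premise `□φ` into the
relations themselves. It remains to show that each triple satisfying the relations in such a
quotient is the image of the generators under a homomorphism from `Z'` (`exists_hom`).

If `x₁ ∨ x₂ = ⊤`, the pair is complementary; the freeness of `Z` gives a homomorphism that factors
through `Z × Z₂`. Otherwise `x₁` and `x₂` are nonzero, hence lie in the image of the part `Z × Z₂`,
and the last relation fails unless the `Z`-component of `x₀` is `g`. This rigidity (`eq_toIic_gens`)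
makes the triple the image of the standard one, reached through `Z₂ → A`.

Infinitude comes from a Kripke model of `Z`, and subdirect irreducibility from the greatest element
of `Z'` below `⊤`. -/

/-! ### Homomorphisms out of free Heyting algebras -/

/-- The value of a Heyting term under a valuation. -/
def HeytTerm.eval {X : Type u} {L : Type v} [HeytingAlgebra L] (f : X → L) : HeytTerm X → L
  | var x => f x
  | bot => ⊥
  | top => ⊤
  | inf s t => eval f s ⊓ eval f t
  | sup s t => eval f s ⊔ eval f t
  | imp s t => eval f s ⇨ eval f t

theorem HeytTerm.Le.eval_le {X : Type u} {L : Type v} [HeytingAlgebra L] (f : X → L)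
    {s t : HeytTerm X} (h : HeytTerm.Le s t) : s.eval f ≤ t.eval f := by
  induction h with
  | refl => exact le_rfl
  | trans _ _ h k => exact h.trans k
  | bot_le => exact _root_.bot_le
  | le_top => exact _root_.le_top
  | inf_left => exact inf_le_left
  | inf_right => exact inf_le_right
  | le_inf _ _ h k => exact _root_.le_inf h k
  | sup_left => exact le_sup_left
  | sup_right => exact le_sup_right
  | sup_le _ _ h k => exact _root_.sup_le h k
  | imp_intro _ h => exact le_himp_iff.2 h
  | imp_elim _ h => exact le_himp_iff.1 h

namespace FreeHeyting

variable {X : Type u} {L : Type v} [HeytingAlgebra L]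

/-- The homomorphism out of the free Heyting algebra that extends a valuation. -/
def lift (f : X → L) : HeytingHom (FreeHeyting X) L where
  toFun := Quotient.lift (HeytTerm.eval f) fun _ _ h =>
    le_antisymm (h.1.eval_le f) (h.2.eval_le f)
  map_sup' := by rintro ⟨a⟩ ⟨b⟩; rfl
  map_inf' := by rintro ⟨a⟩ ⟨b⟩; rfl
  map_bot' := rfl
  map_himp' := by rintro ⟨a⟩ ⟨b⟩; rfl

theorem induction {P : FreeHeyting X → Prop} (h_of : ∀ x, P (of x)) (h_bot : P ⊥)
    (h_inf : ∀ x y, P x → P y → P (x ⊓ y)) (h_sup : ∀ x y, P x → P y → P (x ⊔ y))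
    (h_himp : ∀ x y, P x → P y → P (x ⇨ y)) (x : FreeHeyting X) : P x := by
  obtain ⟨t⟩ := x
  change P (mk t)
  induction t with
  | var x => exact h_of x
  | bot => exact h_bot
  | top => exact (himp_self (a := (⊥ : FreeHeyting X)) ▸ h_himp ⊥ ⊥ h_bot h_bot : P ⊤)
  | inf a b ha hb => exact h_inf _ _ ha hb
  | sup a b ha hb => exact h_sup _ _ ha hb
  | imp a b ha hb => exact h_himp _ _ ha hb

end FreeHeyting

/-! ### Principal quotients of Heyting algebras -/

namespace HeytingAlgebra

variable {H : Type u} [HeytingAlgebra H]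

/-- The principal ideal below `c` as a Heyting algebra: the quotient of `H` by the filter
generated by `c`. -/
instance iic (c : H) : HeytingAlgebra (Set.Iic c) where
  himp x y := ⟨(x.1 ⇨ y.1) ⊓ c, inf_le_right⟩
  compl x := ⟨x.1ᶜ ⊓ c, inf_le_right⟩
  le_top _ := le_top
  bot_le _ := bot_le
  le_himp_iff x y z := by
    change x.1 ≤ (y.1 ⇨ z.1) ⊓ c ↔ x.1 ⊓ y.1 ≤ z.1
    rw [le_inf_iff, le_himp_iff]
    exact and_iff_left x.2
  himp_bot x := Subtype.ext <| by
    change (x.1 ⇨ ⊥) ⊓ c = x.1ᶜ ⊓ c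
    rw [_root_.himp_bot]

/-- The quotient homomorphism `x ↦ x ⊓ c`. -/
def toIic (c : H) : HeytingHom H (Set.Iic c) where
  toFun x := ⟨x ⊓ c, inf_le_right⟩
  map_sup' x y := Subtype.ext (inf_sup_right x y c)
  map_inf' x y := Subtype.ext (inf_inf_distrib_right x y c)
  map_bot' := Subtype.ext (bot_inf_eq c)
  map_himp' x y := Subtype.ext <| by
    change (x ⇨ y) ⊓ c = ((x ⊓ c) ⇨ (y ⊓ c)) ⊓ c
    refine le_antisymm (le_inf (le_himp_iff.2 (le_inf ?_ ?_)) inf_le_right)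
      (le_inf (le_himp_iff.2 ?_) inf_le_right)
    · exact le_trans (by rw [inf_assoc]; gcongr; exact inf_le_right.trans inf_le_left)
        (himp_inf_le (a := x))
    · exact inf_le_left.trans inf_le_right
    · calc ((x ⊓ c) ⇨ (y ⊓ c)) ⊓ c ⊓ x = ((x ⊓ c) ⇨ (y ⊓ c)) ⊓ (x ⊓ c) := by
            rw [inf_assoc, inf_comm c]
        _ ≤ y ⊓ c := himp_inf_le
        _ ≤ y := inf_le_left

theorem toIic_coe {c : H} (x : Set.Iic c) : toIic c x.1 = x := Subtype.ext (inf_eq_left.2 x.2)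

theorem toIic_eq_top {c x : H} : toIic c x = ⊤ ↔ c ≤ x := by
  rw [Subtype.ext_iff]
  exact inf_eq_right

/-- A pair of homomorphisms into `L` and a complemented pair of elements of `L` yield a
homomorphism out of the product. -/
def prodHom {H₁ : Type u} {H₂ : Type v} {L : Type w} [HeytingAlgebra H₁] [HeytingAlgebra H₂]
    [HeytingAlgebra L] (f : HeytingHom H₁ L) (g : HeytingHom H₂ L) {a b : L} (h : IsCompl a b) :
    HeytingHom (H₁ × H₂) L where
  toFun x := f x.1 ⊓ a ⊔ g x.2 ⊓ b
  map_sup' x y := by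
    simp only [Prod.fst_sup, Prod.snd_sup, map_sup, inf_sup_right]
    ac_rfl
  map_inf' x y := by
    have hab : a ⊓ b = ⊥ := h.inf_eq_bot
    have key : ∀ s t : L, s ⊓ a ⊓ (t ⊓ b) = ⊥ := fun s t => by
      rw [inf_inf_inf_comm, hab, inf_bot_eq]
    rw [Prod.fst_inf, Prod.snd_inf, map_inf, map_inf, inf_sup_left, inf_sup_right, inf_sup_right,
      key, inf_comm (g x.2 ⊓ b) (f y.1 ⊓ a), key, sup_bot_eq, bot_sup_eq,
      ← inf_inf_distrib_right, ← inf_inf_distrib_right]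
  map_bot' := by simp
  map_himp' x y := by
    have hab : a ⊓ b = ⊥ := h.inf_eq_bot
    -- Meeting with one member of the complementary pair removes the other summand. Both components
    -- of the implication can thus be tested separately.
    have key : ∀ {c d e s t : L}, c ⊓ d = ⊥ → e ⊓ c ≤ (s ⊓ c ⊔ t ⊓ d) → e ⊓ c ≤ s := by
      intro c d e s t hcd hl
      have : e ⊓ c ≤ (s ⊓ c ⊔ t ⊓ d) ⊓ c := le_inf hl inf_le_right
      rw [inf_sup_right, inf_assoc t, inf_comm d, hcd, inf_bot_eq, sup_bot_eq] at this
      exact this.trans (inf_le_left.trans inf_le_left)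
    refine eq_of_forall_le_iff fun e => ?_
    have split : ∀ e : L, e = e ⊓ a ⊔ e ⊓ b := fun e => by
      rw [← inf_sup_left, h.sup_eq_top, inf_top_eq]
    have hxy : f (x ⇨ y).1 ⊓ a ⊔ g (x ⇨ y).2 ⊓ b =
        (f x.1 ⇨ f y.1) ⊓ a ⊔ (g x.2 ⇨ g y.2) ⊓ b := by
      rw [← map_himp, ← map_himp]; rfl
    rw [hxy]
    constructor
    · intro he
      rw [le_himp_iff, inf_sup_left]
      refine sup_le_sup ?_ ?_
      · refine le_inf ?_ (inf_le_right.trans inf_le_right)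
        have h1 : e ⊓ a ≤ f x.1 ⇨ f y.1 := key hab (inf_le_left.trans he)
        rw [le_himp_iff] at h1
        exact le_trans (by rw [inf_comm (f x.1), inf_assoc]) h1
      · refine le_inf ?_ (inf_le_right.trans inf_le_right)
        have h1 : e ⊓ b ≤ g x.2 ⇨ g y.2 :=
          key ((inf_comm b a).trans hab) (inf_le_left.trans (he.trans (sup_comm _ _).le))
        rw [le_himp_iff] at h1
        exact le_trans (by rw [inf_comm (g x.2), inf_assoc]) h1
    · intro he
      rw [le_himp_iff, inf_sup_left] at he
      rw [split e]
      refine sup_le_sup (le_inf (le_himp_iff.2 ?_) inf_le_right)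
        (le_inf (le_himp_iff.2 ?_) inf_le_right)
      · have h1 := (le_sup_left).trans he
        rw [← inf_assoc] at h1
        have := key hab h1
        exact le_trans (by rw [inf_right_comm]) this
      · have h1 := (le_sup_right).trans he
        rw [← inf_assoc] at h1
        have := key ((inf_comm b a).trans hab) (h1.trans (sup_comm _ _).le)
        exact le_trans (by rw [inf_right_comm]) this

theorem prodHom_apply {H₁ : Type u} {H₂ : Type v} {L : Type w} [HeytingAlgebra H₁]
    [HeytingAlgebra H₂] [HeytingAlgebra L] (f : HeytingHom H₁ L) (g : HeytingHom H₂ L) {a b : L}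
    (h : IsCompl a b) (x : H₁ × H₂) : prodHom f g h x = f x.1 ⊓ a ⊔ g x.2 ⊓ b := rfl

/-- The homomorphism from the two-element algebra. -/
def boolHom (L : Type v) [HeytingAlgebra L] : HeytingHom Bool L where
  toFun i := bif i then ⊤ else ⊥
  map_sup' i j := by cases i <;> cases j <;> simp
  map_inf' i j := by cases i <;> cases j <;> simp
  map_bot' := rfl
  map_himp' i j := by
    cases i <;> cases j
    · exact himp_self.symm
    · exact himp_top.symm
    · exact top_himp.symm
    · exact himp_self.symm

@[simp]
theorem boolHom_true (L : Type v) [HeytingAlgebra L] : boolHom L true = ⊤ := rfl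

@[simp]
theorem boolHom_false (L : Type v) [HeytingAlgebra L] : boolHom L false = ⊥ := rfl

end HeytingAlgebra

/-! ### Concatenation -/

namespace Concat

variable {A : Type u} {B : Type v} {C : Type w} [HeytingAlgebra A] [HeytingAlgebra B]
  [HeytingAlgebra C]

theorem himp_of_le {x y : Concat A B} (h : x.1.1 ≤ y.1.1) : x ⇨ y = inr (x.1.2 ⇨ y.1.2) :=
  if_pos h

theorem himp_of_not_le {x y : Concat A B} (h : ¬ x.1.1 ≤ y.1.1) : x ⇨ y = inl (x.1.1 ⇨ y.1.1) :=
  if_neg h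

/-- The quotient homomorphism `A + B → A`. -/
def toLeft : HeytingHom (Concat A B) A where
  toFun x := x.1.1
  map_sup' _ _ := rfl
  map_inf' _ _ := rfl
  map_bot' := rfl
  map_himp' x y := by
    by_cases h : x.1.1 ≤ y.1.1
    · rw [himp_of_le h]
      exact (himp_eq_top_iff.2 h).symm
    · rw [himp_of_not_le h]
      rfl

@[simp]
theorem toLeft_inl (a : A) : toLeft (inl a : Concat A B) = a := rfl

/-- Functoriality of `A + B` in `B`. -/
def mapRight (f : HeytingHom B C) : HeytingHom (Concat A B) (Concat A C) where
  toFun x := ⟨(x.1.1, f x.1.2), x.2.imp id fun h => by rw [h, map_bot]⟩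
  map_sup' x y := Subtype.ext <| Prod.ext rfl <| map_sup f _ _
  map_inf' x y := Subtype.ext <| Prod.ext rfl <| map_inf f _ _
  map_bot' := Subtype.ext <| Prod.ext rfl <| map_bot f
  map_himp' x y := by
    by_cases h : x.1.1 ≤ y.1.1
    · rw [himp_of_le h]
      refine Eq.trans ?_ (himp_of_le (B := C) (x := ⟨(x.1.1, f x.1.2), _⟩)
        (y := ⟨(y.1.1, f y.1.2), _⟩) h).symm
      exact Subtype.ext <| Prod.ext rfl <| map_himp f _ _
    · rw [himp_of_not_le h]
      refine Eq.trans ?_ (himp_of_not_le (B := C) (x := ⟨(x.1.1, f x.1.2), _⟩)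
        (y := ⟨(y.1.1, f y.1.2), _⟩) h).symm
      exact Subtype.ext <| Prod.ext rfl <| map_bot f

@[simp]
theorem mapRight_inl (f : HeytingHom B C) (a : A) : mapRight f (inl a) = inl a :=
  Subtype.ext <| Prod.ext rfl <| map_bot f

theorem mapRight_injective {f : HeytingHom B C} (hf : Function.Injective f) :
    Function.Injective (mapRight f : HeytingHom (Concat A B) (Concat A C)) := by
  intro x y h
  have h' := congrArg Subtype.val h
  exact Subtype.ext <| Prod.ext (congrArg Prod.fst h' :) (hf (congrArg Prod.snd h' :))

theorem inl_le {a : A} {x : Concat A B} : inl a ≤ x ↔ a ≤ toLeft x :=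
  ⟨fun h => h.1, fun h => ⟨h, bot_le⟩⟩

theorem inl_mono {a b : A} (h : a ≤ b) : (inl a : Concat A B) ≤ inl b := inl_le.2 h

theorem inl_injective : Function.Injective (inl : A → Concat A B) :=
  fun _ _ h => congrArg toLeft h

theorem inl_toLeft_of_snd {x : Concat A B} (h : x.1.2 = ⊥) : inl (toLeft x) = x :=
  Subtype.ext <| Prod.ext rfl h.symm

theorem eq_inl_of_le_inl {a : A} {x : Concat A B} (h : x ≤ inl a) : inl (toLeft x) = x :=
  inl_toLeft_of_snd (le_bot_iff.1 h.2)

theorem inl_inf (a b : A) : (inl (a ⊓ b) : Concat A B) = inl a ⊓ inl b :=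
  Subtype.ext <| Prod.ext rfl (inf_idem _).symm

theorem inl_sup (a b : A) : (inl (a ⊔ b) : Concat A B) = inl a ⊔ inl b :=
  Subtype.ext <| Prod.ext rfl (sup_idem _).symm

theorem inl_bot : (inl ⊥ : Concat A B) = ⊥ := rfl

/-- The pseudo-complement of a nonzero element of `A + B` is computed in `A`. -/
theorem compl_eq_inl {x : Concat A B} (h : x ≠ ⊥) (hA : (⊥ : A) ≠ ⊤) :
    xᶜ = inl (toLeft x)ᶜ := by
  rw [← himp_bot, ← himp_bot]
  refine himp_of_not_le fun hx => h ?_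
  have h0 : toLeft x = ⊥ := le_bot_iff.1 hx
  have h1 : x.1.2 = ⊥ := x.2.resolve_left fun h' => hA (h0.symm.trans h')
  rw [← inl_toLeft_of_snd h1, h0, inl_bot]

/-- Putting `Z₂` on top adds only a new unit, so the old unit becomes the greatest element below it.
Join-irreducibility of `⊤` and subdirect irreducibility both rest on this. -/
theorem le_inl_top_of_ne_top {x : Concat A Bool} (h : x ≠ ⊤) : x ≤ inl ⊤ := by
  refine ⟨le_top, le_of_eq ?_⟩
  cases hx : x.1.2 with
  | false => rfl
  | true =>
    refine absurd (Subtype.ext (Prod.ext (x.2.resolve_right ?_) hx)) h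
    rw [hx]; decide

theorem inl_ne_top (a : A) : (inl a : Concat A Bool) ≠ ⊤ := fun h => by
  have : false = true := congrArg (fun x => x.1.2) h
  exact Bool.false_ne_true this

theorem sup_eq_top {x y : Concat A Bool} (h : x ⊔ y = ⊤) : x = ⊤ ∨ y = ⊤ := by
  by_contra! hxy
  have h1 := sup_le (le_inl_top_of_ne_top hxy.1) (le_inl_top_of_ne_top hxy.2)
  rw [h] at h1
  exact inl_ne_top _ (top_le_iff.1 h1)

end Concat

/-! ### Functoriality of the modal span -/

namespace BoolTerm

variable {H : Type u} {L : Type v}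

/-- The renaming of the constants of a Boolean term. -/
def map (f : H → L) : BoolTerm H → BoolTerm L
  | of a => of (f a)
  | bot => bot
  | top => top
  | inf s t => inf (map f s) (map f t)
  | sup s t => sup (map f s) (map f t)
  | compl s => compl (map f s)

theorem Le.map [HeytingAlgebra H] [HeytingAlgebra L] (f : HeytingHom H L) {s t : BoolTerm H}
    (h : Le s t) : Le (s.map f) (t.map f) := by
  induction h with
  | refl => exact .refl _
  | trans _ _ h k => exact h.trans k
  | bot_le => exact .bot_le _
  | le_top => exact .le_top _
  | inf_left => exact .inf_left _ _
  | inf_right => exact .inf_right _ _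
  | le_inf _ _ h k => exact .le_inf h k
  | sup_left => exact .sup_left _ _
  | sup_right => exact .sup_right _ _
  | sup_le _ _ h k => exact .sup_le h k
  | distrib => exact .distrib _ _ _
  | inf_compl => exact .inf_compl _
  | sup_compl => exact .sup_compl _
  | compl_anti _ h => exact .compl_anti h
  | of_bot =>
    change Le (of (f ⊥)) bot
    rw [map_bot]; exact .of_bot
  | of_top =>
    change Le top (of (f ⊤))
    rw [map_top]; exact .of_top
  | of_mono h => exact .of_mono (OrderHomClass.mono f h)
  | of_inf a b =>
    change Le (inf (of (f a)) (of (f b))) (of (f (a ⊓ b)))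
    rw [map_inf]; exact .of_inf _ _
  | of_sup a b =>
    change Le (of (f (a ⊔ b))) (sup (of (f a)) (of (f b)))
    rw [map_sup]; exact .of_sup _ _

end BoolTerm

namespace ModalSpan

variable {H : Type u} {L : Type v} [HeytingAlgebra H] [HeytingAlgebra L]

theorem of_injective : Function.Injective (of : H → ModalSpan H) := fun _ _ h =>
  le_antisymm (of_le_of.1 h.le) (of_le_of.1 h.ge)

theorem box_eq (x : ModalSpan H) : InteriorAlgebra.box x = box x := rfl

theorem box_himp_of (a b : H) : box (of a ⇨ of b) = of (a ⇨ b) := by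
  have h := box_cnf [(a, b)]
  simpa [cnf, impInf, himp_eq, sup_comm] using h

theorem box_compl_of (a : H) : box (of a)ᶜ = of aᶜ := by
  rw [← himp_bot, ← himp_bot, ← of_bot, box_himp_of]

theorem exists_box_eq_of (x : ModalSpan H) : ∃ a : H, box x = of a := ⟨_, rfl⟩

theorem eq_top_of_box_eq_top {x : ModalSpan H} (h : box x = ⊤) : x = ⊤ :=
  top_le_iff.1 (h ▸ box_le_self x)

/-- The map between modal spans induced by a homomorphism of Heyting algebras. -/
def map (f : HeytingHom H L) : ModalSpan H → ModalSpan L :=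
  Quotient.map (BoolTerm.map f) fun _ _ h => ⟨h.1.map f, h.2.map f⟩

variable (f : HeytingHom H L)

theorem map_of (a : H) : map f (of a) = of (f a) := rfl

theorem map_inf (x y : ModalSpan H) : map f (x ⊓ y) = map f x ⊓ map f y := by
  obtain ⟨x⟩ := x; obtain ⟨y⟩ := y; rfl

theorem map_sup (x y : ModalSpan H) : map f (x ⊔ y) = map f x ⊔ map f y := by
  obtain ⟨x⟩ := x; obtain ⟨y⟩ := y; rfl

theorem map_compl (x : ModalSpan H) : map f xᶜ = (map f x)ᶜ := by
  obtain ⟨x⟩ := x; rfl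

theorem map_top : map f ⊤ = ⊤ := rfl

theorem map_himp (x y : ModalSpan H) : map f (x ⇨ y) = map f x ⇨ map f y := by
  rw [himp_eq, himp_eq, map_sup, map_compl]

theorem map_cnf (l : List (H × H)) : map f (cnf l) = cnf (l.map (Prod.map f f)) := by
  induction l with
  | nil => rfl
  | cons p l ih =>
    change map f (((of p.1)ᶜ ⊔ of p.2) ⊓ cnf l) =
      ((of (f p.1))ᶜ ⊔ of (f p.2)) ⊓ cnf (l.map (Prod.map f f))
    rw [map_inf, map_sup, map_compl, ih, map_of, map_of]

theorem map_impInf (l : List (H × H)) : f (impInf l) = impInf (l.map (Prod.map f f)) := by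
  induction l with
  | nil => exact TopHomClass.map_top f
  | cons p l ih =>
    change f ((p.1 ⇨ p.2) ⊓ impInf l) = (f p.1 ⇨ f p.2) ⊓ impInf (l.map (Prod.map f f))
    rw [InfHomClass.map_inf, HeytingHomClass.map_himp, ih]

theorem map_box (x : ModalSpan H) : map f (box x) = box (map f x) := by
  obtain ⟨l, rfl⟩ := exists_cnf x
  rw [box_cnf, map_cnf, box_cnf, map_of, map_impInf]

theorem map_eval {X : Type w} (a : X → ModalSpan H) (φ : ModalFormula X) :
    map f (φ.eval a) = φ.eval fun i => map f (a i) := by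
  induction φ with
  | var => rfl
  | and φ ψ h k => simp only [ModalFormula.eval, map_inf, h, k]
  | or φ ψ h k => simp only [ModalFormula.eval, map_sup, h, k]
  | imp φ ψ h k => simp only [ModalFormula.eval, map_himp, h, k]
  | neg φ h => simp only [ModalFormula.eval, map_compl, h]
  | box φ h => simp only [ModalFormula.eval, box_eq, map_box, h]

/-- An element is `⊤` as soon as its box is, and boxes lie in the Heyting algebra. Triviality of the
kernel is therefore decided by `f` itself. -/
theorem map_injective {f : HeytingHom H L} (hf : Function.Injective f) :
    Function.Injective (map f) := by
  have key : ∀ x : ModalSpan H, map f x = ⊤ → x = ⊤ := fun x hx => by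
    obtain ⟨a, ha⟩ := exists_box_eq_of x
    have h := map_box f x
    rw [hx, ha, map_of, ← of_top, box_of] at h
    have h' := of_injective h
    rw [← TopHomClass.map_top f] at h'
    exact eq_top_of_box_eq_top (by rw [ha, hf h', of_top])
  have le : ∀ x y : ModalSpan H, map f x = map f y → x ≤ y := fun x y h => by
    rw [← himp_eq_top_iff]
    exact key _ (by rw [map_himp, h, himp_self])
  exact fun x y h => le_antisymm (le x y h) (le y x h.symm)

/-- An algebraic deduction theorem: holding in the quotient by `c` is the same as following from the
open premise `c`. It reduces to open elements, because the quotient map commutes with box. -/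
theorem map_toIic_eq_top {c : H} {x : ModalSpan H} :
    map (HeytingAlgebra.toIic c) x = ⊤ ↔ of c ≤ x := by
  obtain ⟨a, ha⟩ := exists_box_eq_of x
  have h := map_box (HeytingAlgebra.toIic c) x
  rw [ha, map_of] at h
  rw [← of_le_box, ha, of_le_of, ← HeytingAlgebra.toIic_eq_top]
  constructor
  · intro hx
    rw [hx, ← of_top, box_of] at h
    exact of_injective h
  · intro hx
    rw [hx, of_top] at h
    exact eq_top_of_box_eq_top h.symm

end ModalSpan

/-! ### Identities and validity -/

/-- The renaming of the variables of a formula. -/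
def ModalFormula.rename {X : Type u} {Y : Type v} (r : X → Y) : ModalFormula X → ModalFormula Y
  | var x => var (r x)
  | and φ ψ => and (rename r φ) (rename r ψ)
  | or φ ψ => or (rename r φ) (rename r ψ)
  | imp φ ψ => imp (rename r φ) (rename r ψ)
  | neg φ => neg (rename r φ)
  | box φ => box (rename r φ)

theorem ModalFormula.eval_rename {X : Type u} {Y : Type v} {S : Type w} [InteriorAlgebra S]
    (r : X → Y) (a : Y → S) (φ : ModalFormula X) : (φ.rename r).eval a = φ.eval (a ∘ r) := by
  induction φ with
  | var => rfl
  | and φ ψ h k => simp only [rename, eval, h, k]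
  | or φ ψ h k => simp only [rename, eval, h, k]
  | imp φ ψ h k => simp only [rename, eval, h, k]
  | neg φ h => simp only [rename, eval, h]
  | box φ h => simp only [rename, eval, h]

/-- A formula that is valid in `K` is valid in the variety generated by `K`. -/
theorem InteriorVariety.valid_generatedBy {K : Type u} [InteriorAlgebra K] {n : ℕ}
    {φ : ModalFormula (Fin n)} (h : ∀ a : Fin n → K, φ.eval a = ⊤) :
    InteriorVariety.Valid.{0, w} (generatedBy K) φ := by
  intro S _ hS a
  -- Validity is encoded as the identity of `φ` with the tautology `p₀ → p₀`. Variables beyond the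
  -- first `n` do not occur in `φ`, so their default value `⊤` is immaterial.
  have := hS (φ.rename Fin.val, .imp (.var 0) (.var 0)) (fun b => by
    rw [ModalFormula.eval_rename, h, ModalFormula.eval, himp_self])
    (fun i => if hi : i < n then a ⟨i, hi⟩ else ⊤)
  rw [ModalFormula.eval_rename, ModalFormula.eval, himp_self] at this
  rw [← this]
  congr 1
  funext i
  simp

/-- The modal span of a subalgebra belongs to every variety that contains the modal span. -/
theorem ModalSpan.generatedBy_mem {H : Type u} {L : Type v} [HeytingAlgebra H] [HeytingAlgebra L]
    {f : HeytingHom H L} (hf : Function.Injective f) :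
    (InteriorVariety.generatedBy (ModalSpan L)).Mem (ModalSpan H) := fun e he a =>
  map_injective hf (by rw [map_eval, map_eval]; exact he _)

/-- The modal span of a Heyting algebra in which `m` is the greatest element below `⊤` is
subdirectly irreducible. -/
theorem ModalSpan.isSubdirectlyIrreducible {H : Type u} [HeytingAlgebra H] {m : H} (hm : m ≠ ⊤)
    (h : ∀ x : H, x ≠ ⊤ → x ≤ m) : IsSubdirectlyIrreducible (ModalSpan H) := by
  refine ⟨of m, ⊤, fun e => hm (of_injective (e.trans of_top.symm)), ?_⟩
  -- If `x ≰ y`, then `□(x → y)` is an open element below `m` that is congruent to `⊤`. Joining with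
  -- `m` collapses `m` to `⊤`.
  have key : ∀ r : ModalSpan H → ModalSpan H → Prop, IsInteriorCongruence r →
      ∀ x y, r x y → ¬ x ≤ y → r (of m) ⊤ := by
    intro r hr x y hxy hle
    have h1 := hr.box (hr.himp hxy (hr.equivalence.refl y))
    rw [himp_self, box_eq, box_eq, ← of_top, box_of, of_top] at h1
    obtain ⟨a, ha⟩ := exists_box_eq_of (x ⇨ y)
    rw [ha] at h1
    have h2 := hr.sup (hr.equivalence.refl (of m)) h1
    rw [sup_top_eq, ← of_sup, sup_eq_left.2 (h a ?_)] at h2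
    · exact h2
    · rintro rfl
      exact hle (himp_eq_top_iff.1 (eq_top_of_box_eq_top (ha.trans of_top)))
  rintro r hr ⟨x, y, hne, hxy⟩
  by_cases hle : x ≤ y
  · exact key r hr y x (hr.equivalence.symm hxy) fun hle' => hne (le_antisymm hle hle')
  · exact key r hr x y hxy hle

/-! ### The Rieger–Nishimura ladder -/

/-- A Heyting term that has the value `⊤` at every element of the Rieger–Nishimura ladder other
than the generator. -/
def ladderTerm {L : Type u} [HeytingAlgebra L] (x : L) : L := (xᶜᶜ ⇨ x) ⊔ xᶜ ⊔ xᶜᶜ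

theorem map_ladderTerm {H : Type u} {L : Type v} [HeytingAlgebra H] [HeytingAlgebra L]
    (f : HeytingHom H L) (x : H) : f (ladderTerm x) = ladderTerm (f x) := by
  simp only [ladderTerm, map_sup, map_himp, map_compl]

namespace RiegerNishimura

/-- The generator of the Rieger–Nishimura ladder. -/
def gen : RiegerNishimura := FreeHeyting.of ()

/-- In the quotient by `¬g` the generator becomes `⊥`, and in the quotient by `¬¬g` it becomes
dense. The values generated there form chains of at most two and three elements, which are closed
under the operations. -/
theorem inf_compl_gen (x : RiegerNishimura) :
    (x ⊓ genᶜ = ⊥ ∨ x ⊓ genᶜ = genᶜ) ∧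
      (x ⊓ genᶜᶜ = ⊥ ∨ x ⊓ genᶜᶜ = gen ∨ x ⊓ genᶜᶜ = genᶜᶜ) := by
  have hg : gen ≤ genᶜᶜ := le_compl_compl
  have relative : ∀ c x y : RiegerNishimura, (x ⇨ y) ⊓ c = ((x ⊓ c) ⇨ (y ⊓ c)) ⊓ c :=
    fun c x y => congrArg Subtype.val (map_himp (HeytingAlgebra.toIic c) x y)
  have himp_gen : (genᶜᶜ ⇨ gen) ⊓ genᶜᶜ = gen :=
    le_antisymm himp_inf_le (le_inf le_himp hg)
  induction x using FreeHeyting.induction with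
  | h_of x => exact ⟨Or.inl (inf_compl_self _), Or.inr (Or.inl (inf_eq_left.2 hg))⟩
  | h_bot => simp
  | h_inf x y hx hy =>
    rw [inf_inf_distrib_right, inf_inf_distrib_right x y]
    obtain ⟨h1 | h1, h2 | h2 | h2⟩ := hx <;> obtain ⟨k1 | k1, k2 | k2 | k2⟩ := hy <;>
      simp [h1, h2, k1, k2, hg]
  | h_sup x y hx hy =>
    rw [inf_sup_right, inf_sup_right]
    obtain ⟨h1 | h1, h2 | h2 | h2⟩ := hx <;> obtain ⟨k1 | k1, k2 | k2 | k2⟩ := hy <;>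
      simp [h1, h2, k1, k2, hg]
  | h_himp x y hx hy =>
    rw [relative, relative genᶜᶜ]
    constructor
    · rcases hx.1 with h | h <;> rcases hy.1 with k | k <;> simp [h, k]
    · rcases hx.2 with h | h | h <;> rcases hy.2 with k | k | k <;>
        simp [h, k, hg, himp_gen]

/-- An element with no part below `¬g` lies below `¬¬g`, so it is `⊥`, `g` or `¬¬g`. One containing
`¬g` is `¬g` itself or lies above `g ∨ ¬g` and is dense. Away from `g` every case is regular or
dense. -/
theorem ladderTerm_eq_top {x : RiegerNishimura} (h : x ≠ gen) : ladderTerm x = ⊤ := by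
  have le_of_inf : ∀ {c : RiegerNishimura}, x ⊓ cᶜ = ⊥ → x ≤ cᶜᶜ := fun h' =>
    le_compl_iff_disjoint_right.2 (disjoint_iff.2 h')
  obtain ⟨h1 | h1, h2 | h2 | h2⟩ := inf_compl_gen x
  · have hx : x = ⊥ := by rw [← h2]; exact (inf_eq_left.2 (le_of_inf h1)).symm
    simp [ladderTerm, hx]
  · exact absurd ((inf_eq_left.2 (le_of_inf h1)).symm.trans h2) h
  · have hx := (inf_eq_left.2 (le_of_inf h1)).symm.trans h2
    simp [ladderTerm, hx]
  · have hx : x = genᶜ := le_antisymm (by simpa using le_of_inf h2) (inf_eq_right.1 h1)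
    simp [ladderTerm, hx]
  all_goals
    have hg : gen ≤ x := by
      first
        | exact h2 ▸ inf_le_left
        | exact le_compl_compl.trans (h2 ▸ inf_le_left)
    have hx : xᶜ = ⊥ := by
      rw [← le_bot_iff]
      calc xᶜ ≤ genᶜ ⊓ genᶜᶜ :=
            le_inf (compl_le_compl hg) (compl_le_compl (inf_eq_right.1 h1))
        _ = ⊥ := inf_compl_self _
    simp [ladderTerm, hx]

/-- The element `¬g` is an atom or zero: nothing lies strictly between `⊥` and `¬g`. -/
theorem eq_bot_or_compl_le {x : RiegerNishimura} (h : gen ≤ xᶜ) : x = ⊥ ∨ xᶜ ≤ genᶜᶜ := by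
  have hx : x ≤ genᶜ := by simpa using le_compl_comm.1 h
  rcases (inf_compl_gen x).1 with h1 | h1
  · exact Or.inl ((inf_eq_left.2 hx).symm.trans h1)
  · exact Or.inr (compl_le_compl (inf_eq_right.1 h1))

theorem ladderTerm_gen_ne_top : ladderTerm gen ≠ ⊤ := by
  intro h
  -- A countermodel: at `(1, false)` the three disjuncts are `(1, true)`, `(0, true)` and `(2,
  -- false)` in the product. Their join there is the unit, so the additional top is needed to keep
  -- the join proper.
  let m : Concat (Fin 3 × Bool) Bool := Concat.inl (1, false)
  have hm : Concat.toLeft m = (1, false) := rfl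
  have h1 : ladderTerm m = ⊤ := by
    rw [← map_top (FreeHeyting.lift fun _ => m), ← h, map_ladderTerm]
    rfl
  have not_top : ∀ x : Concat (Fin 3 × Bool) Bool, Concat.toLeft x ≠ ⊤ → x ≠ ⊤ := by
    rintro _ hx rfl
    exact hx (map_top _)
  rcases Concat.sup_eq_top h1 with h2 | h2
  · rcases Concat.sup_eq_top h2 with h3 | h3
    · refine not_top _ ?_ h3
      rw [map_himp, map_compl, map_compl, hm]
      decide
    · refine not_top _ ?_ h3
      rw [map_compl, hm]
      decide
  · refine not_top _ ?_ h2
    rw [map_compl, map_compl, hm]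
    decide

instance : Nontrivial RiegerNishimura := ⟨_, _, ladderTerm_gen_ne_top⟩

/-! ### Infinitude of the ladder via a Kripke model -/

/-- The frame of the Rieger–Nishimura ladder, without its root. -/
structure Frame where
  rank : ℕ

/-- Points accessible from `x` are those below it, so lower sets play the role of intuitionistic
propositions. Points of consecutive rank are incomparable. -/
instance : PartialOrder Frame where
  le x y := x.rank = y.rank ∨ x.rank + 2 ≤ y.rank
  le_refl _ := Or.inl rfl
  le_trans _ _ _ := by omega
  le_antisymm x y h k := by
    cases x; cases y
    simp only [Frame.mk.injEq] at *
    omega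

/-- The points of the frame whose rank is less than `n`. -/
def initial (n : ℕ) : LowerSet Frame where
  carrier := {x | x.rank < n}
  lower' := fun x y (h : y.rank = x.rank ∨ y.rank + 2 ≤ x.rank) (hx : x.rank < n) => by
    change y.rank < n
    omega

theorem mem_himp {U V : LowerSet Frame} {x : Frame} :
    x ∈ U ⇨ V ↔ ∀ y ≤ x, y ∈ U → y ∈ V := by
  rw [← LowerSet.Iic_le, le_himp_iff]
  exact ⟨fun h y hy hU => h ⟨hy, hU⟩, fun h y hy => h y hy.1 hy.2⟩

/-- The implication excludes exactly the points that see rank `n`, namely rank `n` itself and all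
ranks from `n + 2` on. Rank `n + 1` is thus the only one that it adds. -/
theorem initial_succ (n : ℕ) :
    initial (n + 2) = initial (n + 1) ⊔ (initial (n + 1) ⇨ initial n) := by
  ext x
  change x.rank < n + 2 ↔ x.rank < n + 1 ∨ x ∈ initial (n + 1) ⇨ initial n
  rw [mem_himp]
  constructor
  · intro h
    by_cases hx : x.rank < n + 1
    · exact Or.inl hx
    · refine Or.inr fun y (hy : y.rank = x.rank ∨ y.rank + 2 ≤ x.rank)
        (hU : y.rank < n + 1) => ?_
      change y.rank < n
      omega
  · rintro (h | h)
    · omega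
    · by_contra hx
      have : n < n := h ⟨n⟩ (Or.inr (by simp only; omega)) (Nat.lt_succ_self n)
      omega

/-- An increasing sequence in the Rieger–Nishimura ladder, two consecutive members at a time. -/
def chain : ℕ → RiegerNishimura × RiegerNishimura
  | 0 => (⊥, gen)
  | n + 1 => ((chain n).2, (chain n).2 ⊔ ((chain n).2 ⇨ (chain n).1))

theorem lift_chain (n : ℕ) :
    FreeHeyting.lift (fun _ => initial 1) (chain n).1 = initial n ∧
      FreeHeyting.lift (fun _ => initial 1) (chain n).2 = initial (n + 1) := by
  induction n with
  | zero =>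
    refine ⟨(map_bot _).trans ?_, rfl⟩
    ext x
    exact ⟨fun h => h.elim, fun h => absurd h (Nat.not_lt_zero _)⟩
  | succ n ih =>
    refine ⟨ih.2, ?_⟩
    rw [initial_succ, chain, map_sup, map_himp, ih.1, ih.2]

instance : Infinite RiegerNishimura := by
  refine Infinite.of_injective (fun n => (chain n).1) fun m n h => ?_
  have key : initial m = initial n := by
    rw [← (lift_chain m).1, ← (lift_chain n).1]
    exact congrArg _ h
  have hmem : ∀ k, k < m ↔ k < n := fun k => SetLike.ext_iff.1 key ⟨k⟩
  have h1 := hmem m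
  have h2 := hmem n
  omega

end RiegerNishimura

/-! ### The presentation -/

/-- The relations that define `Z × Z₂ + Z₂` by three generators. -/
structure IsLadderTriple {L : Type u} [HeytingAlgebra L] (x : Fin 3 → L) : Prop where
  le : x 0 ≤ x 1
  compl_one : (x 1)ᶜ = x 2
  compl_two : (x 2)ᶜ = x 1
  himp_le : x 1 ⇨ ladderTerm (x 0) ≤ x 1 ⊔ x 2

/-! ### The relations as a modal formula -/

namespace ModalFormula

variable {X : Type u}

/-- The formula stating that the value of `φ` is open. -/
def isOpen (φ : ModalFormula X) : ModalFormula X := imp φ (box φ)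

/-- Biconditional. -/
def iff (φ ψ : ModalFormula X) : ModalFormula X := and (imp φ ψ) (imp ψ φ)

/-- Intuitionistic negation. -/
def hneg (φ : ModalFormula X) : ModalFormula X := box (neg φ)

/-- The modal translation of `ladderTerm`. -/
def ladder (φ : ModalFormula X) : ModalFormula X :=
  or (or (box (imp (hneg (hneg φ)) φ)) (hneg φ)) (hneg (hneg φ))

/-- The formula that defines `s(Z × Z₂ + Z₂)`. -/
def ladderPresentation : ModalFormula (Fin 3) :=
  and (and (isOpen (var 0)) (and (isOpen (var 1)) (isOpen (var 2))))
    (and (and (imp (var 0) (var 1)) (imp (box (imp (var 1) (ladder (var 0)))) (or (var 1) (var 2))))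
      (and (iff (hneg (var 1)) (var 2)) (iff (hneg (var 2)) (var 1))))

open ModalSpan in
-- The openness conjuncts force the valuation into `L`. On open elements boxed implications and
-- boxed negations compute the Heyting operations, so the remaining conjuncts become the relations.
theorem eval_ladderPresentation {L : Type v} [HeytingAlgebra L] (a : Fin 3 → ModalSpan L) :
    ladderPresentation.eval a = ⊤ ↔ ∃ x : Fin 3 → L, a = of ∘ x ∧ IsLadderTriple x := by
  have key : ∀ x : Fin 3 → L, ladderPresentation.eval (of ∘ x) = ⊤ ↔ IsLadderTriple x := by
    intro x
    simp only [ladderPresentation, isOpen, iff, hneg, ladder, eval, Function.comp_apply, box_eq,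
      box_compl_of, box_himp_of, box_of, ← of_sup, inf_eq_top_iff, himp_eq_top_iff, of_le_of,
      le_refl, true_and, ← le_antisymm_iff]
    exact ⟨fun ⟨⟨h1, h2⟩, h3, h4⟩ => ⟨h1, h3, h4, h2⟩,
      fun h => ⟨⟨h.le, h.himp_le⟩, h.compl_one, h.compl_two⟩⟩
  constructor
  · intro h
    have h' := h
    simp only [ladderPresentation, isOpen, eval, inf_eq_top_iff, himp_eq_top_iff] at h'
    have hopen : ∀ i, ∃ x : L, a i = of x := by
      have op : ∀ y : ModalSpan L, y ≤ InteriorAlgebra.box y → ∃ x : L, y = of x := fun y hy => by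
        obtain ⟨x, hx⟩ := exists_box_eq_of y
        exact ⟨x, (le_antisymm hy (box_le_self y)).trans hx⟩
      intro i
      fin_cases i
      · exact op _ h'.1.1
      · exact op _ h'.1.2.1
      · exact op _ h'.1.2.2
    choose x hx using hopen
    obtain rfl : a = of ∘ x := funext hx
    exact ⟨x, rfl, (key x).1 h⟩
  · rintro ⟨x, rfl, hx⟩
    exact (key x).2 hx

end ModalFormula

/-! ### Triples in quotients of `Z × Z₂ + A` -/

namespace ZStar

open HeytingAlgebra RiegerNishimura

variable {A : Type u} [HeytingAlgebra A]

/-- The three generators. -/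
noncomputable def gens (A : Type u) [HeytingAlgebra A] : Fin 3 → ZStar A :=
  ![Concat.inl (gen, false), Concat.inl (⊤, false), Concat.inl (⊥, true)]

theorem bot_ne_top_left : (⊥ : RiegerNishimura × Bool) ≠ ⊤ := fun h =>
  Bool.false_ne_true (congrArg Prod.snd h)

/-- The join of the last two generators is the greatest element below `⊤`. The final relation then
only asks that the implication differ from `⊤`, which holds because the term is not `⊤` at the
generator of `Z`. -/
theorem isLadderTriple_gens : IsLadderTriple (gens Bool) where
  le := Concat.inl_mono ⟨le_top, le_rfl⟩
  compl_one := by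
    change (Concat.inl (⊤, false))ᶜ = Concat.inl (⊥, true)
    rw [Concat.compl_eq_inl _ bot_ne_top_left, Concat.toLeft_inl]
    · congr 1
      exact Prod.ext compl_top rfl
    · intro h
      have : (⊤, false) = (⊥ : RiegerNishimura × Bool) := Concat.inl_injective h
      exact top_ne_bot (congrArg Prod.fst this)
  compl_two := by
    change (Concat.inl (⊥, true))ᶜ = Concat.inl (⊤, false)
    rw [Concat.compl_eq_inl _ bot_ne_top_left, Concat.toLeft_inl]
    · congr 1
      exact Prod.ext compl_bot rfl
    · intro h
      have : (⊥, true) = (⊥ : RiegerNishimura × Bool) := Concat.inl_injective h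
      exact Bool.false_ne_true.symm (congrArg Prod.snd this)
  himp_le := by
    have h : gens Bool 1 ⊔ gens Bool 2 = Concat.inl ⊤ := by
      change Concat.inl _ ⊔ Concat.inl _ = _
      rw [← Concat.inl_sup]
      congr 1
      exact Prod.ext (top_sup_eq _) rfl
    rw [h]
    refine Concat.le_inl_top_of_ne_top fun h1 => ?_
    have h2 : ((⊤ : RiegerNishimura), false) ≤ ladderTerm (gen, false) :=
      (map_ladderTerm Concat.toLeft (gens Bool 0)) ▸ Concat.inl_le.1 (himp_eq_top_iff.1 h1)
    exact ladderTerm_gen_ne_top (top_le_iff.1 h2.1)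

/-- A triple in a quotient of `Z × Z₂ + A` whose second and third members do not cover the unit
is the image of the generators. -/
theorem eq_toIic_gens {c : ZStar A} {x : Fin 3 → Set.Iic c} (hx : IsLadderTriple x)
    (hne : x 1 ⊔ x 2 ≠ ⊤) : x = toIic c ∘ gens A := by
  have hbot := bot_ne_top_left
  have h2 : x 2 ≠ ⊥ := fun h => hne (by rw [← hx.compl_two, h, compl_bot, top_sup_eq])
  have h1 : x 1 ≠ ⊥ := fun h => hne (by rw [← hx.compl_one, h, compl_bot, sup_top_eq])
  have ne_coe : ∀ {y : Set.Iic c}, y ≠ ⊥ → y.1 ≠ ⊥ := fun h h' => h (Subtype.ext h')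
  -- A pseudo-complement of a nonzero element is computed in `Z × Z₂`, so the second and third
  -- members lie in that part, and the first one does as it is below the second.
  have e1 : (x 1).1 = Concat.inl (Concat.toLeft (x 2).1)ᶜ ⊓ c := by
    rw [← Concat.compl_eq_inl (ne_coe h2) hbot]
    exact congrArg Subtype.val hx.compl_two.symm
  have e2 : (x 2).1 = Concat.inl (Concat.toLeft (x 1).1)ᶜ ⊓ c := by
    rw [← Concat.compl_eq_inl (ne_coe h1) hbot]
    exact congrArg Subtype.val hx.compl_one.symm
  have l1 : (x 1).1 = Concat.inl (Concat.toLeft (x 1).1) :=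
    (Concat.eq_inl_of_le_inl (e1.trans_le inf_le_left)).symm
  have l2 : (x 2).1 = Concat.inl (Concat.toLeft (x 2).1) :=
    (Concat.eq_inl_of_le_inl (e2.trans_le inf_le_left)).symm
  have hle : (x 0).1 ≤ (x 1).1 := hx.le
  have l0 : (x 0).1 = Concat.inl (Concat.toLeft (x 0).1) :=
    (Concat.eq_inl_of_le_inl (hle.trans (e1.trans_le inf_le_left))).symm
  -- the second member does not lie below the value of the term at the first one
  have hterm : ¬ (Concat.toLeft (x 1).1).1 ≤ ladderTerm (Concat.toLeft (x 0).1).1 := by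
    intro h
    refine hne (top_le_iff.1 (le_trans (top_le_iff.2 (himp_eq_top_iff.2 ?_)) hx.himp_le))
    have h' : (x 1).1 ≤ ladderTerm (x 0).1 := by
      rw [l1, Concat.inl_le, map_ladderTerm]
      refine ⟨h, ?_⟩
      -- In the two-element algebra the term is identically `⊤`, so only the `Z`-component matters.
      change _ ≤ ladderTerm (Concat.toLeft (x 0).1).2
      generalize (Concat.toLeft (x 0).1).2 = i
      generalize (Concat.toLeft (x 1).1).2 = j
      revert i j
      decide
    rw [← toIic_coe (x 0), ← toIic_coe (x 1), ← map_ladderTerm]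
    exact OrderHomClass.mono _ h'
  have hg : (Concat.toLeft (x 0).1).1 = gen := by
    by_contra h
    exact hterm (le_top.trans (ladderTerm_eq_top h).ge)
  have hle' : Concat.toLeft (x 1).1 ≤ (Concat.toLeft (x 2).1)ᶜ :=
    OrderHomClass.mono Concat.toLeft (e1.trans_le inf_le_left)
  have hle0 : Concat.toLeft (x 0).1 ≤ Concat.toLeft (x 1).1 := OrderHomClass.mono Concat.toLeft hle
  -- Otherwise the `Z`-component of the second member would lie below `¬¬g`, a disjunct of the term
  -- at `g`, contrary to `hterm`.
  have hz : (Concat.toLeft (x 2).1).1 = ⊥ := by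
    refine (eq_bot_or_compl_le (hg ▸ (hle0.trans hle').1)).resolve_right fun h => hterm ?_
    rw [hg]
    exact (hle'.1.trans h).trans le_sup_right
  have hi : (Concat.toLeft (x 2).1).2 = true := by
    by_contra h
    refine ne_coe h2 (l2.trans ?_)
    rw [Prod.ext (x := Concat.toLeft (x 2).1) (y := ⊥) hz (Bool.eq_false_iff.2 h), Concat.inl_bot]
  have t2 : Concat.toLeft (x 2).1 = (⊥, true) := Prod.ext hz hi
  have t1 : (Concat.toLeft (x 2).1)ᶜ = (⊤, false) := by
    rw [t2]; exact Prod.ext compl_bot rfl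
  have t0 : Concat.toLeft (x 0).1 = (gen, false) :=
    Prod.ext hg (Bool.eq_false_of_le_false ((hle0.trans (hle'.trans t1.le)).2))
  funext i
  fin_cases i
  · change x 0 = toIic c (Concat.inl (gen, false))
    rw [← t0, ← l0, toIic_coe]
  · change x 1 = toIic c (Concat.inl (⊤, false))
    rw [← t1]
    exact Subtype.ext e1
  · change x 2 = toIic c (Concat.inl (⊥, true))
    rw [← t2, ← l2, toIic_coe]

/-- Every triple satisfying the relations in a quotient of `Z × Z₂ + A` is the image of the
generators of `Z × Z₂ + Z₂` under a homomorphism. -/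
theorem exists_hom {c : ZStar A} {x : Fin 3 → Set.Iic c} (hx : IsLadderTriple x) :
    ∃ f : HeytingHom ZPrime (Set.Iic c), f ∘ gens Bool = x := by
  by_cases h : x 1 ⊔ x 2 = ⊤
  · have hc : IsCompl (x 1) (x 2) :=
      ⟨hx.compl_one ▸ disjoint_compl_right, codisjoint_iff.2 h⟩
    -- The complementary pair splits the quotient: `Z` is sent below `x 1` by freeness, and `Z₂`
    -- below `x 2`.
    refine ⟨(prodHom (FreeHeyting.lift fun _ => x 0) (boolHom _) hc).comp Concat.toLeft, ?_⟩
    funext i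
    simp only [Function.comp_apply, HeytingHom.comp_apply, prodHom_apply]
    fin_cases i
    · change x 0 ⊓ x 1 ⊔ ⊥ ⊓ x 2 = x 0
      simp [hx.le]
    · change FreeHeyting.lift _ ⊤ ⊓ x 1 ⊔ ⊥ ⊓ x 2 = x 1
      simp
    · change FreeHeyting.lift _ ⊥ ⊓ x 1 ⊔ ⊤ ⊓ x 2 = x 2
      simp
  · refine ⟨(toIic c).comp (Concat.mapRight (boolHom A)), ?_⟩
    rw [eq_toIic_gens hx h]
    funext i
    simp only [Function.comp_apply, HeytingHom.comp_apply]
    congr 1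
    fin_cases i <;> exact Concat.mapRight_inl _ _

/-- Boxing implications recovers those of `Z'`, so the open elements obtained are closed under the
Heyting operations. They exhaust `Z'`, which generates its span by Boolean operations. -/
theorem generates : GeneratesInterior (ModalSpan.of ∘ gens Bool) := by
  intro T hT hinf hsup himp hcompl hbox
  have hHimp : ∀ x y : ZPrime, ModalSpan.of x ∈ T → ModalSpan.of y ∈ T →
      ModalSpan.of (x ⇨ y) ∈ T := fun x y hx hy => by
    rw [← ModalSpan.box_himp_of]
    exact hbox _ (himp _ hx _ hy)
  have hInf : ∀ x y : ZPrime, ModalSpan.of x ∈ T → ModalSpan.of y ∈ T →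
      ModalSpan.of (x ⊓ y) ∈ T := fun x y hx hy => by
    rw [ModalSpan.of_inf]
    exact hinf _ hx _ hy
  have hSup : ∀ x y : ZPrime, ModalSpan.of x ∈ T → ModalSpan.of y ∈ T →
      ModalSpan.of (x ⊔ y) ∈ T := fun x y hx hy => by
    rw [ModalSpan.of_sup]
    exact hsup _ hx _ hy
  have hleft : ∀ z : RiegerNishimura, ModalSpan.of (Concat.inl (z, false) : ZPrime) ∈ T := by
    intro z
    induction z using FreeHeyting.induction with
    | h_of z => exact hT 0
    | h_bot =>
      have h := hInf _ _ (hT 1) (hT 2)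
      rwa [← isLadderTriple_gens.compl_one, inf_compl_self] at h
    | h_inf x y hx hy =>
      have h := hInf _ _ hx hy
      rwa [← Concat.inl_inf] at h
    | h_sup x y hx hy =>
      have h := hSup _ _ hx hy
      rwa [← Concat.inl_sup] at h
    | h_himp x y hx hy =>
      -- The implication taken in `Z'` leaves the factor `Z`, since its `Z₂`-component is true.
      -- Meeting with the second generator cuts it back.
      have h := hInf _ _ (hHimp _ _ hx hy) (hT 1)
      convert h using 2
      have e := Concat.eq_inl_of_le_inl (A := RiegerNishimura × Bool) (B := Bool)
        (x := (Concat.inl (x, false) ⇨ Concat.inl (y, false)) ⊓ gens Bool 1)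
        (inf_le_right : _ ≤ Concat.inl (⊤, false))
      rw [← e, map_inf, map_himp]
      congr 1
      exact Prod.ext (inf_top_eq _).symm rfl
  have hall : ∀ z : ZPrime, ModalSpan.of z ∈ T := by
    intro z
    by_cases hz : z = ⊤
    · rw [hz, ← himp_self (a := gens Bool 0)]
      exact hHimp _ _ (hT 0) (hT 0)
    · rw [← Concat.eq_inl_of_le_inl (Concat.le_inl_top_of_ne_top hz)]
      obtain ⟨y, i⟩ := Concat.toLeft z
      cases i with
      | false => exact hleft y
      | true =>
        have h := hSup _ _ (hleft y) (hT 2)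
        convert h using 2
        change _ = Concat.inl _ ⊔ Concat.inl _
        rw [← Concat.inl_sup]
        congr 1
        exact Prod.ext (sup_bot_eq _).symm rfl
  refine Set.eq_univ_of_forall fun x => ?_
  exact ModalSpan.induction hall (fun x y hx hy => hinf x hx y hy) hcompl x

theorem finitelyPresentableOver (A : Type u) [HeytingAlgebra A] [Nontrivial A] :
    FinitelyPresentableOver.{0, w}
      (InteriorVariety.generatedBy (ModalSpan (ZStar A))) (ModalSpan ZPrime) := by
  -- Non-degeneracy of `A` enters here; it embeds `Z'` into `Z × Z₂ + A` and so yields membership in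
  -- the variety.
  have hinj : Function.Injective (boolHom A) := by
    intro i j h
    cases i <;> cases j <;> simp_all
  refine ⟨ModalSpan.generatedBy_mem (Concat.mapRight_injective hinj), 3,
    ModalFormula.ladderPresentation, ModalSpan.of ∘ gens Bool, generates,
    (ModalFormula.eval_ladderPresentation _).2 ⟨_, rfl, isLadderTriple_gens⟩, fun ψ hψ => ?_⟩
  refine InteriorVariety.valid_generatedBy fun b => himp_eq_top_iff.2 ?_
  -- The premise `□φ` is an open element `c`. In the quotient by `c` the relations hold, so `ψ` is
  -- carried over from `s(Z')` along the homomorphism, which means that `c` lies below the value of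
  -- `ψ`.
  obtain ⟨c, hc⟩ := ModalSpan.exists_box_eq_of (ModalFormula.ladderPresentation.eval b)
  change ModalSpan.box _ ≤ _
  rw [hc, ← ModalSpan.map_toIic_eq_top, ModalSpan.map_eval]
  have h : ModalSpan.map (toIic c) (ModalFormula.ladderPresentation.eval b) = ⊤ :=
    ModalSpan.map_toIic_eq_top.2 (hc ▸ ModalSpan.box_le_self _)
  rw [ModalSpan.map_eval, ModalFormula.eval_ladderPresentation] at h
  obtain ⟨x, hx, hx'⟩ := h
  obtain ⟨f, rfl⟩ := exists_hom hx'
  rw [hx, ← ModalSpan.map_top f, ← hψ, ModalSpan.map_eval]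
  rfl

end ZStar

theorem theorem7p3 :
    (∀ (A : Type u) [HeytingAlgebra A] [Nontrivial A],
      FinitelyPresentableOver.{0, w}
        (InteriorVariety.generatedBy (ModalSpan (ZStar A))) (ModalSpan ZPrime)) ∧
    (Infinite (ModalSpan ZPrime) ∧ IsSubdirectlyIrreducible (ModalSpan ZPrime) ∧
      FinitelyPresentableOver.{0, w}
        (InteriorVariety.generatedBy (ModalSpan ZPrime)) (ModalSpan ZPrime)) := by
  refine ⟨fun A _ _ => ZStar.finitelyPresentableOver A, ?_,
    ModalSpan.isSubdirectlyIrreducible (Concat.inl_ne_top ⊤)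
      fun x hx => Concat.le_inl_top_of_ne_top hx,
    ZStar.finitelyPresentableOver Bool⟩
  exact Infinite.of_injective
    (fun z : RiegerNishimura => ModalSpan.of (Concat.inl (z, false) : ZPrime)) fun x y h =>
      congrArg Prod.fst (Concat.inl_injective (ModalSpan.of_injective h))
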